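/- Let $n\ge 1$ and let $y_i=\mu_i^*+\epsilon_i$, $i=1,\dots,n$, with $\mu^*\in\mathbb R^n$ and $\epsilon_1,\dots,\epsilon_n$ i.i.d. $N(0,\sigma^2)$, $\sigma>0$; write $Y=(y_1,\dots,y_n)^T$. Let $A\in\mathbb R^{n\times n}$ have entries $A_{ij}=1$ for $i\ge j$ and $0$ otherwise, put $\theta^*=A^{-1}\mu^*$ (that is, $\theta_1^*=\mu_1^*$ and $\theta_i^*=\mu_i^*-\mu_{i-1}^*$ for $i\ge 2$) and $\tilde\theta^*=(\theta_2^*,\dots,\theta_n^*)^T$. Let $X\in\mathbb R^{n\times(n-1)}$ have entries $x_{ij}=1$ for $i>j$ and $0$ for $i\le j$, let $\bar X$ be the row vector of its column averages, let $\tilde X$ be $X$ with each column centered by its average, and let $\tilde Y=Y-\bar Y$, where $\bar Y$ is the average of the entries of $Y$. For $b\in\mathbb R^{n-1}$ put $\hat\mu(Y,b)=A\,[\hat\theta_1,b]$ with $\hat\theta_1=\bar Y-\bar X b$. (i) For every $Y\in\mathbb R^n$ and $\lambda_2\ge 0$, a vector $\mu$ minimizes the fused Lasso signal approximator objective with $\lambda_1=0$,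 namely $\frac12\|Y-\mu\|_2^2+\lambda_2\sum_{i=1}^{n-1}|\mu_{i+1}-\mu_i|$, if and only if $\mu=\hat\mu(Y,b)$ for some minimizer $b$ of $\frac12\|\tilde Y-\tilde X b\|_2^2+\lambda_2\|b\|_1$. (ii) $\tilde X$ has a singular value decomposition $\tilde X=UDV^T$ with $U\in\mathbb R^{n\times(n-1)}$, $V\in\mathbb R^{(n-1)\times(n-1)}$, $U^TU=V^TV=I_{n-1}$ and $D$ diagonal with nonnegative entries, and in every such decomposition the diagonal entries of $D$ are positive. Given any such decomposition, let $F=UD^{-1}U^T$ (the Puffer transformation), $Z=F\tilde X$ and $a=F\tilde Y$. Let $\lambda\ge 0$ be such that $|\theta_j^*|\ge 2\lambda$ for every $j\ge 2$ with $\theta_j^*\ne 0$. Then the Lasso problem $$\tilde\beta(\lambda)=\mathop{\mathrm{argmin}}_{b\in\mathbb R^{n-1}}\ \tfrac12\|a-Zb\|_2^2+\lambda\|b\|_1$$ has exactly one solution, and with probability greater than $$1-2n\exp\left\{-\frac{\lambda^2}{8\sigma^2}\right\}$$ it satisfies $\mathrm{sign}(\tilde\beta_j(\lambda))=\mathrm{sign}(\tilde\theta^*_j)$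 for all $j=1,\dots,n-1$. This sign equality holds if and only if the preconditioned fused Lasso estimate $\hat\mu^*=\hat\mu(Y,\tilde\beta(\lambda))$ satisfies $\mathrm{sign}(\hat\mu^*_{i+1}-\hat\mu^*_i)=\mathrm{sign}(\mu^*_{i+1}-\mu^*_i)$ for all $i=1,\dots,n-1$; hence $\hat\mu^*$ recovers the jump pattern of $\mu^*$ with probability greater than the same bound. -/

import Mathlib

open MeasureTheory ProbabilityTheory Matrix

noncomputable section

namespace FusedLasso

/-! The number of observations is `n = m + 1`, so vectors of observations are indexed by
`Fin (m + 1)` and vectors of jumps by `Fin m`. -/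

/-- The average of the entries of a vector. -/
def average {m : ℕ} (u : Fin (m + 1) → ℝ) : ℝ := (∑ i, u i) / ((m + 1 : ℕ) : ℝ)

/-- The centered version `u - ū` of a vector. -/
def center {m : ℕ} (u : Fin (m + 1) → ℝ) : Fin (m + 1) → ℝ := fun i => u i - average u

/-- The `n × n` lower triangular matrix of ones. -/
def matA (m : ℕ) : Matrix (Fin (m + 1)) (Fin (m + 1)) ℝ :=
  Matrix.of fun i j => if j ≤ i then 1 else 0

/-- The `n × (n - 1)` design matrix, with entry `1` for `i > j` and `0` for `i ≤ j`. -/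
def matX (m : ℕ) : Matrix (Fin (m + 1)) (Fin m) ℝ :=
  Matrix.of fun i j => if j.castSucc < i then 1 else 0

/-- The column averages of `matX`. -/
def avgX (m : ℕ) : Fin m → ℝ := fun j => average fun i => matX m i j

/-- The design matrix with centered columns. -/
def matXc (m : ℕ) : Matrix (Fin (m + 1)) (Fin m) ℝ :=
  Matrix.of fun i j => center (fun k => matX m k j) i

/-- `θ = A⁻¹ μ`. -/
def theta {m : ℕ} (μ : Fin (m + 1) → ℝ) : Fin (m + 1) → ℝ := (matA m)⁻¹ *ᵥ μ

/-- The jump vector: `θ` without its first entry. -/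
def thetaTilde {m : ℕ} (μ : Fin (m + 1) → ℝ) : Fin m → ℝ := Fin.tail (theta μ)

/-- The Lasso objective `½ ‖a - Z b‖₂² + lam ‖b‖₁`. -/
def lassoObjective {ι κ : Type*} [Fintype ι] [Fintype κ]
    (Z : Matrix ι κ ℝ) (a : ι → ℝ) (lam : ℝ) (b : κ → ℝ) : ℝ :=
  1 / 2 * ∑ i, (a i - (Z *ᵥ b) i) ^ 2 + lam * ∑ j, |b j|

/-- `b` is a Lasso solution for the data `(Z, a)` with parameter `lam`. -/
def IsLasso {ι κ : Type*} [Fintype ι] [Fintype κ]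
    (Z : Matrix ι κ ℝ) (a : ι → ℝ) (lam : ℝ) (b : κ → ℝ) : Prop :=
  ∀ b' : κ → ℝ, lassoObjective Z a lam b ≤ lassoObjective Z a lam b'

/-- The objective `½ ‖y - μ‖₂² + lam₁ ‖μ‖₁ + lam₂ ‖μ‖_TV` of the fused Lasso signal
approximator. -/
def flsaObjective {m : ℕ} (y : Fin (m + 1) → ℝ) (lam₁ lam₂ : ℝ) (μ : Fin (m + 1) → ℝ) : ℝ :=
  1 / 2 * ∑ i, (y i - μ i) ^ 2 + lam₁ * ∑ i, |μ i|
    + lam₂ * ∑ i : Fin m, |μ i.succ - μ i.castSucc|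

/-- `μ` is a solution of the fused Lasso signal approximator. -/
def IsFLSA {m : ℕ} (y : Fin (m + 1) → ℝ) (lam₁ lam₂ : ℝ) (μ : Fin (m + 1) → ℝ) : Prop :=
  ∀ μ' : Fin (m + 1) → ℝ, flsaObjective y lam₁ lam₂ μ ≤ flsaObjective y lam₁ lam₂ μ'

/-- The signal estimate `A [θ̂₁, b]` with `θ̂₁ = ȳ - X̄ b` that belongs to an estimate `b` of the
jump vector. -/
def signalEstimate {m : ℕ} (y : Fin (m + 1) → ℝ) (b : Fin m → ℝ) : Fin (m + 1) → ℝ :=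
  matA m *ᵥ (Fin.cons (average y - avgX m ⬝ᵥ b) b : Fin (m + 1) → ℝ)

/-- Two vectors have the same signs. -/
def SignEq {κ : Type*} (u v : κ → ℝ) : Prop :=
  ∀ j, SignType.sign (u j) = SignType.sign (v j)

/-- Two signals have the same jump signs. -/
def JumpSignEq {m : ℕ} (μ ν : Fin (m + 1) → ℝ) : Prop :=
  ∀ i : Fin m, SignType.sign (μ i.succ - μ i.castSucc) = SignType.sign (ν i.succ - ν i.castSucc)

/-- `X = U D Vᵀ` with `D = diag d` is a (thin) singular value decomposition, for a matrix with at
least as many rows as columns. -/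
structure IsSVD {ι κ : Type*} [Fintype κ] [Fintype ι] [DecidableEq κ]
    (X : Matrix ι κ ℝ) (U : Matrix ι κ ℝ) (d : κ → ℝ) (V : Matrix κ κ ℝ) : Prop where
  left_orthonormal : Uᵀ * U = 1
  right_orthonormal : Vᵀ * V = 1
  nonneg : ∀ j, 0 ≤ d j
  eq_mul : X = U * Matrix.diagonal d * Vᵀ

/-- The Puffer transformation `F = U D⁻¹ Uᵀ`. -/
def puffer {ι κ : Type*} [Fintype κ] [DecidableEq κ]
    (U : Matrix ι κ ℝ) (d : κ → ℝ) : Matrix ι ι ℝ :=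
  U * (Matrix.diagonal d)⁻¹ * Uᵀ

end FusedLasso

end

/-!
Put `μ = A [θ₁, b]`. Splitting `‖y - μ‖²` into its centered part and `n (ȳ - μ̄)²` turns the fused
Lasso objective into the centered Lasso objective at the jump vector `b` of `μ` plus a penalty that
vanishes exactly when `μ̄ = ȳ`, that is, when `θ₁ = ȳ - X̄ b`.

Since `X̃` sends the jump vector of a signal to the centered signal, the preconditioned data are
`a = F Ỹ = Z g` with `g` the jump vector of `Y`. As `Z = U Vᵀ` has orthonormal columns, the
preconditioned Lasso separates into scalar problems, solved by soft thresholding of `g`. This has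
the signs of the true jumps as soon as every jump of the noise is smaller than `λ` in absolute
value. A jump of the noise is the difference of two `σ²`-sub-Gaussian variables, hence
`(σ + σ)²`-sub-Gaussian; a union bound over the jumps gives the probability.
-/

namespace FusedLasso

open scoped BigOperators

/-- The jump vector of a signal, that is, its consecutive differences. It is the explicit form of
`thetaTilde`, free of the matrix inverse. -/
def jumps {m : ℕ} (μ : Fin (m + 1) → ℝ) : Fin m → ℝ := fun i => μ i.succ - μ i.castSucc

/-! ### Averages -/

section Average

variable {m : ℕ}

lemma average_eq_expect (u : Fin (m + 1) → ℝ) : average u = 𝔼 i, u i := by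
  simp only [average, Fintype.expect_eq_sum_div_card, Fintype.card_fin]

lemma average_sub (u v : Fin (m + 1) → ℝ) : average (u - v) = average u - average v := by
  simp only [average_eq_expect, Pi.sub_apply, Finset.expect_sub_distrib]

lemma average_const_add (c : ℝ) (u : Fin (m + 1) → ℝ) :
    average (fun i => c + u i) = c + average u := by
  simp only [average_eq_expect, Finset.expect_add_distrib, Fintype.expect_const]

lemma average_mulVec {κ : Type*} [Fintype κ] (M : Matrix (Fin (m + 1)) κ ℝ) (b : κ → ℝ) :
    average (M *ᵥ b) = (fun j => average fun i => M i j) ⬝ᵥ b := by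
  simp only [average_eq_expect, mulVec, dotProduct, Finset.expect_sum_comm, Finset.expect_mul]

lemma center_sub (u v : Fin (m + 1) → ℝ) : center (u - v) = center u - center v := by
  funext i
  simp only [center, average_sub, Pi.sub_apply]
  ring

lemma center_const_add (c : ℝ) (u : Fin (m + 1) → ℝ) :
    center (fun i => c + u i) = center u := by
  funext i
  simp only [center, average_const_add, add_sub_add_left_eq_sub]

lemma sum_sq_eq_sum_center_sq_add (u : Fin (m + 1) → ℝ) :
    ∑ i, u i ^ 2 = ∑ i, center u i ^ 2 + ((m + 1 : ℕ) : ℝ) * average u ^ 2 := by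
  have hsum : ∑ i, u i = ((m + 1 : ℕ) : ℝ) * average u :=
    (mul_div_cancel₀ _ (by positivity)).symm
  have hterm : ∀ i, u i ^ 2 = center u i ^ 2 + (2 * average u * u i - average u ^ 2) := by
    intro i
    simp only [center]
    ring
  simp only [hterm, Finset.sum_add_distrib, Finset.sum_sub_distrib, ← Finset.mul_sum, hsum,
    Finset.sum_const, Finset.card_univ, Fintype.card_fin, nsmul_eq_mul]
  ring

end Average

/-! ### Signals and their jumps -/

section Jumps

variable {m : ℕ}

lemma jumps_const_add (c : ℝ) (μ : Fin (m + 1) → ℝ) : jumps (fun i => c + μ i) = jumps μ := by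
  funext i
  simp only [jumps, add_sub_add_left_eq_sub]

lemma jumps_center (μ : Fin (m + 1) → ℝ) : jumps (center μ) = jumps μ := by
  funext i
  simp only [jumps, center, sub_sub_sub_cancel_right]

lemma jumps_matX_mulVec (b : Fin m → ℝ) : jumps (matX m *ᵥ b) = b := by
  funext i
  have hrow (j : Fin m) : matX m i.succ j - matX m i.castSucc j = if j = i then 1 else 0 := by
    simp only [matX, of_apply, Fin.lt_def, Fin.ext_iff, Fin.val_castSucc, Fin.val_succ]
    split_ifs <;> first | omega | norm_num
  simp only [jumps, mulVec, dotProduct, ← Finset.sum_sub_distrib, ← sub_mul, hrow, ite_mul,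
    one_mul, zero_mul, Finset.sum_ite_eq', Finset.mem_univ, if_true]

lemma eq_of_zero_eq_of_jumps_eq {μ ν : Fin (m + 1) → ℝ} (h0 : μ 0 = ν 0)
    (hjumps : jumps μ = jumps ν) : μ = ν := by
  funext i
  induction i using Fin.induction with
  | zero => exact h0
  | succ i ih =>
    have hi : μ i.succ - μ i.castSucc = ν i.succ - ν i.castSucc := congrFun hjumps i
    linarith

lemma add_matX_mulVec_jumps (μ : Fin (m + 1) → ℝ) :
    (fun i => μ 0 + (matX m *ᵥ jumps μ) i) = μ := by
  refine eq_of_zero_eq_of_jumps_eq ?_ ?_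
  · simp [mulVec, dotProduct, matX]
  · rw [jumps_const_add, jumps_matX_mulVec]

lemma matA_mulVec_cons (c : ℝ) (b : Fin m → ℝ) :
    matA m *ᵥ (Fin.cons c b : Fin (m + 1) → ℝ) = fun i => c + (matX m *ᵥ b) i := by
  funext i
  have hle (j : Fin m) : j.succ ≤ i ↔ j.castSucc < i := by
    simp only [Fin.le_def, Fin.lt_def, Fin.val_succ, Fin.val_castSucc, Nat.succ_le_iff]
  simp only [mulVec, dotProduct, Fin.sum_univ_succ, matA, matX, of_apply, hle, Fin.cons_zero,
    Fin.cons_succ, Fin.zero_le, if_true, one_mul]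

lemma det_matA (m : ℕ) : (matA m).det = 1 := by
  rw [det_of_isLowerTriangular]
  · simp [matA]
  · intro i j hij
    have hlt : i < j := hij
    simp [matA, hlt]

lemma thetaTilde_eq_jumps (μ : Fin (m + 1) → ℝ) : thetaTilde μ = jumps μ := by
  have hdet : IsUnit (matA m).det := by simp [det_matA]
  have htheta : theta μ = Fin.cons (μ 0) (jumps μ) := by
    conv_lhs => rw [theta, ← add_matX_mulVec_jumps μ, ← matA_mulVec_cons, mulVec_mulVec,
      nonsing_inv_mul _ hdet, one_mulVec]
  rw [thetaTilde, htheta, Fin.tail_cons]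

lemma matXc_mulVec (b : Fin m → ℝ) : matXc m *ᵥ b = center (matX m *ᵥ b) := by
  funext i
  rw [center, average_mulVec]
  simp only [matXc, center, mulVec, dotProduct, of_apply, sub_mul, Finset.sum_sub_distrib]

lemma matXc_mulVec_jumps (μ : Fin (m + 1) → ℝ) : matXc m *ᵥ jumps μ = center μ := by
  rw [matXc_mulVec, ← center_const_add (μ 0), add_matX_mulVec_jumps]

lemma matXc_mulVec_injective (m : ℕ) : Function.Injective (matXc m).mulVec := by
  refine Function.LeftInverse.injective (g := jumps) fun b => ?_
  rw [matXc_mulVec, jumps_center, jumps_matX_mulVec]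

lemma jumps_signalEstimate (y : Fin (m + 1) → ℝ) (b : Fin m → ℝ) :
    jumps (signalEstimate y b) = b := by
  rw [signalEstimate, matA_mulVec_cons, jumps_const_add, jumps_matX_mulVec]

lemma average_signalEstimate (y : Fin (m + 1) → ℝ) (b : Fin m → ℝ) :
    average (signalEstimate y b) = average y := by
  rw [signalEstimate, matA_mulVec_cons, average_const_add, average_mulVec]
  exact sub_add_cancel _ _

lemma eq_of_average_eq_of_jumps_eq {μ ν : Fin (m + 1) → ℝ} (havg : average μ = average ν)
    (hjumps : jumps μ = jumps ν) : μ = ν := by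
  have hcenter : center μ = center ν := by rw [← matXc_mulVec_jumps, hjumps, matXc_mulVec_jumps]
  funext i
  simpa only [center, havg, sub_left_inj] using congrFun hcenter i

lemma signEq_thetaTilde_iff_jumpSignEq (y μ : Fin (m + 1) → ℝ) (b : Fin m → ℝ) :
    SignEq b (thetaTilde μ) ↔ JumpSignEq (signalEstimate y b) μ := by
  rw [thetaTilde_eq_jumps]
  conv_lhs => rw [← jumps_signalEstimate y b]
  rfl

end Jumps

/-! ### The signal approximator as a centered Lasso -/

section SignalApproximator

variable {m : ℕ}

lemma flsaObjective_zero_eq (y μ : Fin (m + 1) → ℝ) (lam : ℝ) :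
    flsaObjective y 0 lam μ = lassoObjective (matXc m) (center y) lam (jumps μ) +
      ((m + 1 : ℕ) : ℝ) / 2 * (average y - average μ) ^ 2 := by
  have hsq := sum_sq_eq_sum_center_sq_add (y - μ)
  simp only [center_sub, average_sub, Pi.sub_apply] at hsq
  rw [flsaObjective, lassoObjective, matXc_mulVec_jumps, hsq]
  simp only [jumps]
  ring

lemma flsaObjective_zero_signalEstimate (y : Fin (m + 1) → ℝ) (lam : ℝ) (b : Fin m → ℝ) :
    flsaObjective y 0 lam (signalEstimate y b) = lassoObjective (matXc m) (center y) lam b := by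
  rw [flsaObjective_zero_eq, jumps_signalEstimate, average_signalEstimate]
  ring

lemma lassoObjective_jumps_le_flsaObjective_zero (y μ : Fin (m + 1) → ℝ) (lam : ℝ) :
    lassoObjective (matXc m) (center y) lam (jumps μ) ≤ flsaObjective y 0 lam μ := by
  rw [flsaObjective_zero_eq]
  exact le_add_of_nonneg_right (by positivity)

lemma IsFLSA.average_eq {y μ : Fin (m + 1) → ℝ} {lam : ℝ} (h : IsFLSA y 0 lam μ) :
    average μ = average y := by
  have hle := h (signalEstimate y (jumps μ))
  rw [flsaObjective_zero_signalEstimate, flsaObjective_zero_eq] at hle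
  by_contra hne
  have hpos : 0 < ((m + 1 : ℕ) : ℝ) / 2 * (average y - average μ) ^ 2 :=
    mul_pos (by positivity) (sq_pos_iff.2 (sub_ne_zero.2 (Ne.symm hne)))
  linarith

lemma isFLSA_zero_iff (y : Fin (m + 1) → ℝ) (lam : ℝ) (μ : Fin (m + 1) → ℝ) :
    IsFLSA y 0 lam μ ↔ ∃ b, IsLasso (matXc m) (center y) lam b ∧ μ = signalEstimate y b := by
  constructor
  · intro h
    refine ⟨jumps μ, fun b => ?_, eq_of_average_eq_of_jumps_eq ?_ ?_⟩
    · calc lassoObjective (matXc m) (center y) lam (jumps μ)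
          ≤ flsaObjective y 0 lam μ := lassoObjective_jumps_le_flsaObjective_zero y μ lam
        _ ≤ flsaObjective y 0 lam (signalEstimate y b) := h _
        _ = lassoObjective (matXc m) (center y) lam b := flsaObjective_zero_signalEstimate y lam b
    · rw [h.average_eq, average_signalEstimate]
    · rw [jumps_signalEstimate]
  · rintro ⟨b, hb, rfl⟩ ν
    rw [flsaObjective_zero_signalEstimate]
    exact (hb (jumps ν)).trans (lassoObjective_jumps_le_flsaObjective_zero y ν lam)

end SignalApproximator

/-! ### Soft thresholding -/

/-- The soft-thresholding function: the minimizer of `t ↦ ½ (g - t)² + lam |t|`, for `lam ≥ 0`. -/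
noncomputable def softThreshold (lam g : ℝ) : ℝ :=
  if lam < g then g - lam else if g < -lam then g + lam else 0

-- The quadratic term on the left makes the minimizer unique.
lemma softThreshold_objective_add_le {lam : ℝ} (hlam : 0 ≤ lam) (g t : ℝ) :
    1 / 2 * (g - softThreshold lam g) ^ 2 + lam * |softThreshold lam g|
      + 1 / 2 * (t - softThreshold lam g) ^ 2 ≤ 1 / 2 * (g - t) ^ 2 + lam * |t| := by
  have hupper : lam * t ≤ lam * |t| := mul_le_mul_of_nonneg_left (le_abs_self t) hlam
  have hlower : lam * -t ≤ lam * |t| := mul_le_mul_of_nonneg_left (neg_le_abs t) hlam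
  unfold softThreshold
  split_ifs with hg hg'
  · rw [abs_of_pos (by linarith)]
    linarith
  · rw [abs_of_neg (by linarith)]
    linarith
  · have hg_abs : |g| ≤ lam := abs_le.2 ⟨by linarith, by linarith⟩
    have hgt : g * t ≤ lam * |t| := by
      calc g * t ≤ |g| * |t| := (le_abs_self _).trans_eq (abs_mul g t)
        _ ≤ lam * |t| := by gcongr
    rw [abs_zero]
    linarith

lemma sign_softThreshold_add {lam θ η : ℝ} (hη : |η| < lam) (hθ : θ ≠ 0 → 2 * lam ≤ |θ|) :
    SignType.sign (softThreshold lam (θ + η)) = SignType.sign θ := by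
  obtain ⟨hη_lower, hη_upper⟩ := abs_lt.1 hη
  unfold softThreshold
  rcases lt_trichotomy θ 0 with hneg | rfl | hpos
  · have hlarge := hθ hneg.ne
    rw [abs_of_neg hneg] at hlarge
    rw [if_neg (by linarith), if_pos (by linarith), sign_neg hneg, sign_neg (by linarith)]
  · rw [if_neg (by linarith), if_neg (by linarith)]
  · have hlarge := hθ hpos.ne'
    rw [abs_of_pos hpos] at hlarge
    rw [if_pos (by linarith), sign_pos hpos, sign_pos (by linarith)]

lemma signEq_softThreshold_jumps_add {m : ℕ} {lam : ℝ} {μ η : Fin (m + 1) → ℝ}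
    (hη : ∀ j, |jumps η j| < lam) (hμ : ∀ j, thetaTilde μ j ≠ 0 → 2 * lam ≤ |thetaTilde μ j|) :
    SignEq (softThreshold lam ∘ jumps (μ + η)) (thetaTilde μ) := by
  intro j
  have hsum : jumps (μ + η) j = thetaTilde μ j + jumps η j := by
    simp only [thetaTilde_eq_jumps, jumps, Pi.add_apply]
    ring
  rw [Function.comp_apply, hsum]
  exact sign_softThreshold_add (hη j) (hμ j)

/-! ### The Puffer-transformed Lasso -/

section Lasso

variable {ι κ : Type*} [Fintype ι] [Fintype κ] [DecidableEq κ]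

lemma sum_mulVec_sq_of_orthonormal {Z : Matrix ι κ ℝ} (hZ : Zᵀ * Z = 1) (v : κ → ℝ) :
    ∑ i, (Z *ᵥ v) i ^ 2 = ∑ j, v j ^ 2 := by
  calc ∑ i, (Z *ᵥ v) i ^ 2 = Z *ᵥ v ⬝ᵥ Z *ᵥ v := by simp only [dotProduct, sq]
    _ = v ⬝ᵥ v := by rw [dotProduct_mulVec, ← mulVec_transpose, mulVec_mulVec, hZ, one_mulVec]
    _ = ∑ j, v j ^ 2 := by simp only [dotProduct, sq]

lemma lassoObjective_mulVec_of_orthonormal {Z : Matrix ι κ ℝ} (hZ : Zᵀ * Z = 1) (g : κ → ℝ)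
    (lam : ℝ) (b : κ → ℝ) :
    lassoObjective Z (Z *ᵥ g) lam b = ∑ j, (1 / 2 * (g j - b j) ^ 2 + lam * |b j|) := by
  have hsq := sum_mulVec_sq_of_orthonormal hZ (g - b)
  simp only [mulVec_sub, Pi.sub_apply] at hsq
  rw [lassoObjective, hsq, Finset.sum_add_distrib, Finset.mul_sum, Finset.mul_sum]

lemma lassoObjective_softThreshold_add_le {Z : Matrix ι κ ℝ} (hZ : Zᵀ * Z = 1) (g : κ → ℝ)
    {lam : ℝ} (hlam : 0 ≤ lam) (b : κ → ℝ) :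
    lassoObjective Z (Z *ᵥ g) lam (softThreshold lam ∘ g) +
        ∑ j, 1 / 2 * (b j - softThreshold lam (g j)) ^ 2 ≤
      lassoObjective Z (Z *ᵥ g) lam b := by
  rw [lassoObjective_mulVec_of_orthonormal hZ, lassoObjective_mulVec_of_orthonormal hZ,
    ← Finset.sum_add_distrib]
  exact Finset.sum_le_sum fun j _ => softThreshold_objective_add_le hlam (g j) (b j)

lemma isLasso_mulVec_iff_of_orthonormal {Z : Matrix ι κ ℝ} (hZ : Zᵀ * Z = 1) (g : κ → ℝ)
    {lam : ℝ} (hlam : 0 ≤ lam) (b : κ → ℝ) :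
    IsLasso Z (Z *ᵥ g) lam b ↔ b = softThreshold lam ∘ g := by
  have hgap := lassoObjective_softThreshold_add_le hZ g hlam
  have hnonneg (b : κ → ℝ) (j : κ) : 0 ≤ 1 / 2 * (b j - softThreshold lam (g j)) ^ 2 := by
    positivity
  constructor
  · intro hb
    have hzero : ∑ j, 1 / 2 * (b j - softThreshold lam (g j)) ^ 2 = 0 :=
      le_antisymm (by linarith [hgap b, hb (softThreshold lam ∘ g)])
        (Finset.sum_nonneg fun j _ => hnonneg b j)
    funext j
    have hj := (Fintype.sum_eq_zero_iff_of_nonneg (hnonneg b)).1 hzero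
    simpa [sub_eq_zero] using congrFun hj j
  · rintro rfl b
    exact (le_add_of_nonneg_right (Finset.sum_nonneg fun j _ => hnonneg b j)).trans (hgap b)

variable {X U : Matrix ι κ ℝ} {d : κ → ℝ} {V : Matrix κ κ ℝ}

lemma isUnit_det_diagonal_of_pos (hd : ∀ j, 0 < d j) : IsUnit (diagonal d).det := by
  rw [det_diagonal]
  exact (Finset.prod_pos fun j _ => hd j).ne'.isUnit

lemma exists_orthogonal_diagonalization_transpose_mul_self
    (hX : Function.Injective X.mulVec) :
    ∃ (e : κ → ℝ) (V : Matrix κ κ ℝ),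
      (∀ j, 0 < e j) ∧ Vᵀ * V = 1 ∧ Vᵀ * (Xᵀ * X) * V = diagonal e := by
  have hpd : (Xᵀ * X).PosDef := by simpa using PosDef.conjTranspose_mul_self X hX
  have horth := Unitary.coe_star_mul_self hpd.isHermitian.eigenvectorUnitary
  have hdiag := hpd.isHermitian.conjStarAlgAut_star_eigenvectorUnitary
  rw [Unitary.conjStarAlgAut_star_apply] at hdiag
  exact ⟨hpd.isHermitian.eigenvalues, hpd.isHermitian.eigenvectorUnitary, hpd.eigenvalues_pos,
    by simpa [star_eq_conjTranspose] using horth, by simpa [star_eq_conjTranspose] using hdiag⟩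

lemma isSVD_of_transpose_mul_mul_eq_diagonal_sq (hd : ∀ j, 0 < d j) (hV : Vᵀ * V = 1)
    (hdiag : Vᵀ * (Xᵀ * X) * V = diagonal d * diagonal d) :
    IsSVD X (X * V * (diagonal d)⁻¹) d V where
  left_orthonormal := by
    have hdet := isUnit_det_diagonal_of_pos hd
    calc (X * V * (diagonal d)⁻¹)ᵀ * (X * V * (diagonal d)⁻¹)
        = (diagonal d)⁻¹ * (Vᵀ * (Xᵀ * X) * V) * (diagonal d)⁻¹ := by
          simp only [transpose_mul, transpose_nonsing_inv, diagonal_transpose, Matrix.mul_assoc]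
      _ = ((diagonal d)⁻¹ * diagonal d) * (diagonal d * (diagonal d)⁻¹) := by
          simp only [hdiag, Matrix.mul_assoc]
      _ = 1 := by rw [nonsing_inv_mul _ hdet, mul_nonsing_inv _ hdet, Matrix.one_mul]
  right_orthonormal := hV
  nonneg j := (hd j).le
  eq_mul := by
    rw [nonsing_inv_mul_cancel_right _ _ (isUnit_det_diagonal_of_pos hd), Matrix.mul_assoc,
      mul_eq_one_comm.1 hV, Matrix.mul_one]

lemma exists_isSVD (hX : Function.Injective X.mulVec) : ∃ U d V, IsSVD X U d V := by
  obtain ⟨e, V, he, hV, hdiag⟩ := exists_orthogonal_diagonalization_transpose_mul_self hX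
  refine ⟨_, _, V, isSVD_of_transpose_mul_mul_eq_diagonal_sq (d := fun j => √(e j))
    (fun j => Real.sqrt_pos.2 (he j)) hV ?_⟩
  simp only [hdiag, diagonal_mul_diagonal, Real.mul_self_sqrt (he _).le]

lemma IsSVD.pos (h : IsSVD X U d V) (hX : Function.Injective X.mulVec) (j : κ) : 0 < d j := by
  have hVinj : Function.Injective V.mulVec :=
    Function.LeftInverse.injective (g := (Vᵀ).mulVec) fun v => by
      rw [mulVec_mulVec, h.right_orthonormal, one_mulVec]
  refine (h.nonneg j).lt_of_ne' fun hzero => ?_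
  have hker : X *ᵥ (V *ᵥ Pi.single j 1) = 0 := by
    rw [h.eq_mul, mulVec_mulVec, Matrix.mul_assoc, h.right_orthonormal, Matrix.mul_one,
      ← mulVec_mulVec, diagonal_mulVec_single, hzero, zero_mul, Pi.single_zero, mulVec_zero]
  have hsingle : Pi.single j (1 : ℝ) = (0 : κ → ℝ) :=
    (hX.comp hVinj) (by simpa using hker)
  simpa using congrFun hsingle j

lemma IsSVD.puffer_mul (h : IsSVD X U d V) (hd : ∀ j, 0 < d j) : puffer U d * X = U * Vᵀ := by
  calc puffer U d * X = U * (diagonal d)⁻¹ * (Uᵀ * U) * diagonal d * Vᵀ := by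
        rw [puffer, h.eq_mul]
        simp only [Matrix.mul_assoc]
    _ = U * Vᵀ := by
        rw [h.left_orthonormal, Matrix.mul_one,
          nonsing_inv_mul_cancel_right _ _ (isUnit_det_diagonal_of_pos hd)]

lemma IsSVD.puffer_mul_orthonormal (h : IsSVD X U d V) (hd : ∀ j, 0 < d j) :
    (puffer U d * X)ᵀ * (puffer U d * X) = 1 := by
  rw [h.puffer_mul hd, transpose_mul, transpose_transpose, Matrix.mul_assoc,
    ← Matrix.mul_assoc Uᵀ, h.left_orthonormal, Matrix.one_mul]
  exact mul_eq_one_comm.1 h.right_orthonormal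

lemma IsSVD.isLasso_puffer_iff (h : IsSVD X U d V) (hd : ∀ j, 0 < d j) (g : κ → ℝ) {lam : ℝ}
    (hlam : 0 ≤ lam) (b : κ → ℝ) :
    IsLasso (puffer U d * X) (puffer U d *ᵥ (X *ᵥ g)) lam b ↔ b = softThreshold lam ∘ g := by
  rw [mulVec_mulVec]
  exact isLasso_mulVec_iff_of_orthonormal (h.puffer_mul_orthonormal hd) g hlam b

lemma IsSVD.isLasso_puffer_center_iff {m : ℕ} {U : Matrix (Fin (m + 1)) (Fin m) ℝ}
    {d : Fin m → ℝ} {V : Matrix (Fin m) (Fin m) ℝ} (h : IsSVD (matXc m) U d V)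
    (y : Fin (m + 1) → ℝ) {lam : ℝ} (hlam : 0 ≤ lam) (b : Fin m → ℝ) :
    IsLasso (puffer U d * matXc m) (puffer U d *ᵥ center y) lam b ↔
      b = softThreshold lam ∘ jumps y := by
  rw [← matXc_mulVec_jumps]
  exact h.isLasso_puffer_iff (h.pos (matXc_mulVec_injective m)) (jumps y) hlam b

end Lasso

/-! ### Sub-Gaussian noise -/

section Noise

variable {Ω : Type*} [MeasurableSpace Ω] {P : Measure Ω}

lemma hasSubgaussianMGF_id_gaussianReal (v : NNReal) :
    HasSubgaussianMGF id v (gaussianReal 0 v) where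
  integrable_exp_mul := integrable_exp_mul_gaussianReal
  mgf_le t := by simp [mgf_id_gaussianReal]

lemma hasSubgaussianMGF_of_hasLaw_gaussianReal {X : Ω → ℝ} {v : NNReal}
    (hX : HasLaw X (gaussianReal 0 v) P) : HasSubgaussianMGF X v P :=
  .of_map hX.aemeasurable (X := id) (hX.map_eq ▸ hasSubgaussianMGF_id_gaussianReal v)

lemma hasSubgaussianMGF_jumps {m : ℕ} {ε : Fin (m + 1) → Ω → ℝ} {c : NNReal}
    (hε : ∀ i, HasSubgaussianMGF (ε i) c P) (j : Fin m) :
    HasSubgaussianMGF (fun ω => jumps (fun i => ε i ω) j) (4 * c) P := by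
  have hproxy : (c.sqrt + c.sqrt) ^ 2 = 4 * c := by
    rw [← two_mul, mul_pow, NNReal.sq_sqrt]
    norm_num
  simpa only [hproxy, Pi.neg_apply, ← sub_eq_add_neg, jumps] using
    (hε j.succ).add (hε j.castSucc).neg

lemma measureReal_le_abs_le {X : Ω → ℝ} {c : NNReal}
    (hX : HasSubgaussianMGF X c P) {t : ℝ} (ht : 0 ≤ t) :
    P.real {ω | t ≤ |X ω|} ≤ 2 * Real.exp (-t ^ 2 / (2 * c)) := by
  calc P.real {ω | t ≤ |X ω|} = P.real ({ω | t ≤ X ω} ∪ {ω | t ≤ (-X) ω}) := by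
        simp only [le_abs, Set.ofPred_or, Pi.neg_apply]
    _ ≤ P.real {ω | t ≤ X ω} + P.real {ω | t ≤ (-X) ω} := measureReal_union_le _ _
    _ ≤ 2 * Real.exp (-t ^ 2 / (2 * c)) := by
        linarith [hX.measure_ge_le ht, hX.neg.measure_ge_le ht]

lemma one_sub_le_measureReal_forall_abs_lt [IsProbabilityMeasure P] {κ : Type*} [Fintype κ]
    {X : κ → Ω → ℝ} {c : NNReal} (hX : ∀ j, HasSubgaussianMGF (X j) c P) {t : ℝ} (ht : 0 ≤ t) :
    1 - 2 * Fintype.card κ * Real.exp (-t ^ 2 / (2 * c)) ≤ P.real {ω | ∀ j, |X j ω| < t} := by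
  have hcompl : {ω | ∀ j, |X j ω| < t}ᶜ = ⋃ j, {ω | t ≤ |X j ω|} := by
    ext ω
    simp
  have htail : P.real {ω | ∀ j, |X j ω| < t}ᶜ ≤
      2 * Fintype.card κ * Real.exp (-t ^ 2 / (2 * c)) := by
    calc P.real {ω | ∀ j, |X j ω| < t}ᶜ ≤ ∑ j, P.real {ω | t ≤ |X j ω|} :=
          hcompl ▸ measureReal_iUnion_fintype_le _
      _ ≤ ∑ _j : κ, 2 * Real.exp (-t ^ 2 / (2 * c)) :=
          Finset.sum_le_sum fun j _ => measureReal_le_abs_le (hX j) ht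
      _ = 2 * Fintype.card κ * Real.exp (-t ^ 2 / (2 * c)) := by
          simp only [Finset.sum_const, Finset.card_univ, nsmul_eq_mul]
          ring
  have hone : 1 ≤ P.real {ω | ∀ j, |X j ω| < t} + P.real {ω | ∀ j, |X j ω| < t}ᶜ := by
    simpa using measureReal_union_le (μ := P) {ω | ∀ j, |X j ω| < t} {ω | ∀ j, |X j ω| < t}ᶜ
  linarith

lemma lt_measureReal_forall_abs_jumps_lt [IsProbabilityMeasure P] {m : ℕ}
    {ε : Fin (m + 1) → Ω → ℝ} {c : NNReal} (hε : ∀ i, HasSubgaussianMGF (ε i) c P)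
    {lam : ℝ} (hlam : 0 ≤ lam) :
    1 - 2 * ((m + 1 : ℕ) : ℝ) * Real.exp (-(lam ^ 2 / (8 * c))) <
      P.real {ω | ∀ j, |jumps (fun i => ε i ω) j| < lam} := by
  have hexp : -lam ^ 2 / (2 * (4 * c : NNReal)) = -(lam ^ 2 / (8 * c)) := by
    push_cast
    ring
  have hbound := one_sub_le_measureReal_forall_abs_lt (hasSubgaussianMGF_jumps hε) hlam
  rw [hexp, Fintype.card_fin] at hbound
  refine lt_of_lt_of_le ?_ hbound
  gcongr
  exact m.lt_succ_self

end Noise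

end FusedLasso

open FusedLasso in
theorem theorem4p2_general {Ω : Type*} [MeasurableSpace Ω] (P : Measure Ω)
    [IsProbabilityMeasure P] (m : ℕ) (μs : Fin (m + 1) → ℝ) (σ : ℝ) (hσ : 0 < σ)
    (ε : Fin (m + 1) → Ω → ℝ) (hε : ∀ i, HasSubgaussianMGF (ε i) (Real.toNNReal (σ ^ 2)) P)
    (Y : Ω → Fin (m + 1) → ℝ) (hY : ∀ ω i, Y ω i = μs i + ε i ω)
    (lam : ℝ) (hlam : 0 ≤ lam)
    (hjump : ∀ j, thetaTilde μs j ≠ 0 → 2 * lam ≤ |thetaTilde μs j|) :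
    (∀ (y : Fin (m + 1) → ℝ) (lam₂ : ℝ) (μ : Fin (m + 1) → ℝ),
      IsFLSA y 0 lam₂ μ ↔
        ∃ b, IsLasso (matXc m) (center y) lam₂ b ∧ μ = signalEstimate y b) ∧
    (∃ U d V, IsSVD (matXc m) U d V) ∧
    ∀ U d V, IsSVD (matXc m) U d V →
      (∀ j, 0 < d j) ∧
      (∀ ω, ∃! b, IsLasso (puffer U d * matXc m) (puffer U d *ᵥ center (Y ω)) lam b) ∧
      ∀ β : Ω → Fin m → ℝ,
        (∀ ω, IsLasso (puffer U d * matXc m) (puffer U d *ᵥ center (Y ω)) lam (β ω)) →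
        1 - 2 * ((m + 1 : ℕ) : ℝ) * Real.exp (-(lam ^ 2 / (8 * σ ^ 2))) <
            P.real {ω | SignEq (β ω) (thetaTilde μs)} ∧
        (∀ ω, SignEq (β ω) (thetaTilde μs) ↔ JumpSignEq (signalEstimate (Y ω) (β ω)) μs) ∧
        1 - 2 * ((m + 1 : ℕ) : ℝ) * Real.exp (-(lam ^ 2 / (8 * σ ^ 2))) <
            P.real {ω | JumpSignEq (signalEstimate (Y ω) (β ω)) μs} := by
  have hinj := matXc_mulVec_injective m
  refine ⟨isFLSA_zero_iff, exists_isSVD hinj, fun U d V hsvd => ?_⟩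
  have hlasso ω b := hsvd.isLasso_puffer_center_iff (Y ω) hlam b
  refine ⟨hsvd.pos hinj, fun ω => by simp only [hlasso, existsUnique_eq], fun β hβ => ?_⟩
  have hsign : {ω | ∀ j, |jumps (fun i => ε i ω) j| < lam} ⊆
      {ω | SignEq (β ω) (thetaTilde μs)} := by
    intro ω hω
    have hYω : Y ω = μs + fun i => ε i ω := funext (hY ω)
    rw [Set.mem_ofPred_eq, (hlasso ω _).1 (hβ ω), hYω]
    exact signEq_softThreshold_jumps_add hω hjump
  have hprob := (lt_measureReal_forall_abs_jumps_lt hε hlam).trans_le (measureReal_mono hsign)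
  rw [Real.coe_toNNReal _ (pow_pos hσ 2).le] at hprob
  have hiff (ω : Ω) := signEq_thetaTilde_iff_jumpSignEq (Y ω) μs (β ω)
  exact ⟨hprob, hiff, by simpa only [hiff] using hprob⟩

theorem theorem4p2 {Ω : Type*} [MeasurableSpace Ω] (P : Measure Ω) [IsProbabilityMeasure P]
    (m : ℕ) (μs : Fin (m + 1) → ℝ) (σ : ℝ) (hσ : 0 < σ)
    (ε : Fin (m + 1) → Ω → ℝ) (hindep : iIndepFun ε P)
    (hlaw : ∀ i, HasLaw (ε i) (gaussianReal 0 (Real.toNNReal (σ ^ 2))) P)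
    (Y : Ω → Fin (m + 1) → ℝ) (hY : ∀ ω i, Y ω i = μs i + ε i ω)
    (lam : ℝ) (hlam : 0 ≤ lam)
    (hjump : ∀ j, FusedLasso.thetaTilde μs j ≠ 0 → 2 * lam ≤ |FusedLasso.thetaTilde μs j|) :
    -- the signal approximator with `λ₁ = 0` is the centered Lasso
    (∀ (y : Fin (m + 1) → ℝ) (lam₂ : ℝ), 0 ≤ lam₂ → ∀ μ : Fin (m + 1) → ℝ,
      FusedLasso.IsFLSA y 0 lam₂ μ ↔
        ∃ b, FusedLasso.IsLasso (FusedLasso.matXc m) (FusedLasso.center y) lam₂ b ∧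
          μ = FusedLasso.signalEstimate y b) ∧
    -- the centered design has a singular value decomposition, with invertible `D`
    (∃ U d V, FusedLasso.IsSVD (FusedLasso.matXc m) U d V) ∧
    ∀ U d V, FusedLasso.IsSVD (FusedLasso.matXc m) U d V →
      (∀ j, 0 < d j) ∧
      -- the preconditioned Lasso has exactly one solution
      (∀ ω, ∃! b, FusedLasso.IsLasso (FusedLasso.puffer U d * FusedLasso.matXc m)
        (FusedLasso.puffer U d *ᵥ FusedLasso.center (Y ω)) lam b) ∧
      ∀ β : Ω → Fin m → ℝ,
        (∀ ω, FusedLasso.IsLasso (FusedLasso.puffer U d * FusedLasso.matXc m)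
          (FusedLasso.puffer U d *ᵥ FusedLasso.center (Y ω)) lam (β ω)) →
        1 - 2 * ((m + 1 : ℕ) : ℝ) * Real.exp (-(lam ^ 2 / (8 * σ ^ 2))) <
            P.real {ω | FusedLasso.SignEq (β ω) (FusedLasso.thetaTilde μs)} ∧
        (∀ ω, FusedLasso.SignEq (β ω) (FusedLasso.thetaTilde μs) ↔
          FusedLasso.JumpSignEq (FusedLasso.signalEstimate (Y ω) (β ω)) μs) ∧
        1 - 2 * ((m + 1 : ℕ) : ℝ) * Real.exp (-(lam ^ 2 / (8 * σ ^ 2))) <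
            P.real {ω | FusedLasso.JumpSignEq
              (FusedLasso.signalEstimate (Y ω) (β ω)) μs} := by
  have hmain := theorem4p2_general P m μs σ hσ ε
    (fun i => FusedLasso.hasSubgaussianMGF_of_hasLaw_gaussianReal (hlaw i)) Y hY lam hlam hjump
  exact ⟨fun y lam₂ _ => hmain.1 y lam₂, hmain.2⟩
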